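/- Let $\mathcal X,\mathcal Y$ be compact Polish spaces, $\mu,\nu$ Borel probability measures on $\mathcal X$ and $\mathcal Y$, and $c:\mathcal X\times\mathcal Y\to[0,\infty)$ a continuous cost (for example $\mathcal X,\mathcal Y\subset\mathbb R^d$ compact and $c(x,y)=\tau\|x-y\|_2^2$ with $\tau>0$). For $i=1,2$ let $\Psi_i:\mathbb R\to[0,\infty]$ be an entropy function, i.e. convex, lower semicontinuous, with $\Psi_i(x)=\infty$ for $x<0$, whose convex conjugate $\Psi_i^*(x)=\sup_{y\in\mathbb R}(xy-\Psi_i(y))$ satisfies $\Psi_i^*(0)=0$ and $(\Psi_i^*)'(0)=1$. For finite positive Borel measures $\rho,\sigma$ on the same space, with Lebesgue decomposition $\rho=\frac{d\rho}{d\sigma}\sigma+\rho^\perp$, let $$D_{\Psi}(\rho|\sigma)=\int\Psi\Big(\frac{d\rho}{d\sigma}\Big)\,d\sigma+\Psi'_\infty\,\rho^\perp(\text{whole space}),\qquad \Psi'_\infty=\lim_{x\to\infty}\frac{\Psi(x)}{x},\qquad \infty\cdot0=0,$$ be the Csiszár divergence. Let $$C(\mu,\nu)=\inf_{\pi\in\Pi(\mu,\nu)}\int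 c\,d\pi,\qquad C^\alpha_{ub}(\mu,\nu)=\inf_{\pi}\Big[\int c\,d\pi+\alpha D_{\Psi_1}(\pi_0|\mu)+\alpha D_{\Psi_2}(\pi_1|\nu)\Big],$$ where $\Pi(\mu,\nu)$ is the set of measures on $\mathcal X\times\mathcal Y$ with marginals $\mu,\nu$, and the second infimum is over all finite positive Borel measures $\pi$ on $\mathcal X\times\mathcal Y$, with marginals $\pi_0$ and $\pi_1$. A minimizer is called an optimal plan. Assume that $\Psi_1,\Psi_2$ are strictly convex and finite on $(0,\infty)$. Then $C(\mu,\nu)$ has an optimal plan, and so has $C^\alpha_{ub}(\mu,\nu)$ for every $\alpha>0$. If the optimal plan $\pi^\star$ of $C(\mu,\nu)$ is unique, then for every choice of optimal plans $\pi^{\alpha,\star}$ of $C^\alpha_{ub}(\mu,\nu)$, $\alpha>0$, one has $\pi^{\alpha,\star}\to\pi^\star$ weakly as $\alpha\to\infty$. In general, every weakly open set of finite positive Borel measures on $\mathcal X\times\mathcal Y$ that contains all optimal plans of $C(\mu,\nu)$ contains, for all sufficiently large $\alpha$, all optimal plans of $C^\alpha_{ub}(\mu,\nu)$. -/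

import Mathlib

open MeasureTheory Filter Topology Set
open scoped ENNReal NNReal

namespace UOT

/-- An entropy function `Ψ : ℝ → [0, ∞]`: convex, lower semicontinuous, and `+∞` on the negative
half-line (convexity of an extended-valued function uses convex combinations with `ℝ≥0` weights). -/
structure IsEntropyFunction (Ψ : ℝ → ℝ≥0∞) : Prop where
  convexOn : ConvexOn ℝ≥0 univ Ψ
  lowerSemicontinuous : LowerSemicontinuous Ψ
  eq_top_of_neg : ∀ x < 0, Ψ x = ⊤

/-- The convex conjugate `Ψ*(x) = sup_y (x y - Ψ(y))`. -/
noncomputable def conjugate (Ψ : ℝ → ℝ≥0∞) (x : ℝ) : EReal :=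
  ⨆ y : ℝ, ((x * y : ℝ) : EReal) - (Ψ y : EReal)

/-- The normalization `Ψ*(0) = 0`, `(Ψ*)'(0) = 1`; differentiability at `0` includes that `Ψ*` is
finite near `0`. -/
structure IsNormalized (Ψ : ℝ → ℝ≥0∞) : Prop where
  conjugate_zero : conjugate Ψ 0 = 0
  conjugate_ne_top : ∀ᶠ x in 𝓝 (0 : ℝ), conjugate Ψ x ≠ ⊤
  hasDerivAt_conjugate : HasDerivAt (fun x : ℝ => (conjugate Ψ x).toReal) 1 0

/-- The recession constant `Ψ'_∞ = lim_{x → ∞} Ψ(x) / x`. -/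
noncomputable def recession (Ψ : ℝ → ℝ≥0∞) : ℝ≥0∞ :=
  limsup (fun x : ℝ => Ψ x / ENNReal.ofReal x) atTop

/-- The Csiszár divergence `D_Ψ(ρ|μ) = ∫ Ψ(dρ/dμ) dμ + Ψ'_∞ ρ^⊥(Z)`, with `ρ = (dρ/dμ) μ + ρ^⊥`
the Lebesgue decomposition and `∞ * 0 = 0`. If `Ψ` is superlinear, it is `∞` unless `ρ ≪ μ`. -/
noncomputable def csiszarDiv {Z : Type*} [MeasurableSpace Z] (Ψ : ℝ → ℝ≥0∞) (ρ μ : Measure Z) :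
    ℝ≥0∞ :=
  ∫⁻ z, Ψ (ρ.rnDeriv μ z).toReal ∂μ + recession Ψ * ρ.singularPart μ univ

variable {X Y : Type*} [MeasurableSpace X] [MeasurableSpace Y]

/-- The transport cost `∫ c dπ` of a plan, for a non-negative cost `c`. -/
noncomputable def transportCost (c : X × Y → ℝ≥0) (π : FiniteMeasure (X × Y)) : ℝ≥0∞ :=
  ∫⁻ p, (c p : ℝ≥0∞) ∂(π : Measure (X × Y))

/-- `Π(μ, ν)`: the plans with marginals `μ` and `ν`. -/
def couplings (μ : Measure X) (ν : Measure Y) : Set (FiniteMeasure (X × Y)) :=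
  {π | (π : Measure (X × Y)).fst = μ ∧ (π : Measure (X × Y)).snd = ν}

/-- The Kantorovich value `C(μ, ν)`. -/
noncomputable def otValue (c : X × Y → ℝ≥0) (μ : Measure X) (ν : Measure Y) : ℝ≥0∞ :=
  ⨅ π ∈ couplings μ ν, transportCost c π

/-- The set of optimal plans of the Kantorovich problem. -/
def otPlans (c : X × Y → ℝ≥0) (μ : Measure X) (ν : Measure Y) : Set (FiniteMeasure (X × Y)) :=
  {π | π ∈ couplings μ ν ∧ transportCost c π = otValue c μ ν}

/-- The objective of the `α`-scaled unbalanced problem. -/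
noncomputable def uotObjective (c : X × Y → ℝ≥0) (Ψ₁ Ψ₂ : ℝ → ℝ≥0∞) (μ : Measure X)
    (ν : Measure Y) (α : ℝ) (π : FiniteMeasure (X × Y)) : ℝ≥0∞ :=
  transportCost c π + ENNReal.ofReal α * csiszarDiv Ψ₁ (π : Measure (X × Y)).fst μ
    + ENNReal.ofReal α * csiszarDiv Ψ₂ (π : Measure (X × Y)).snd ν

/-- The value `C_ub^α(μ, ν)`, an infimum over all finite positive measures on `X × Y`. -/
noncomputable def uotValue (c : X × Y → ℝ≥0) (Ψ₁ Ψ₂ : ℝ → ℝ≥0∞) (μ : Measure X)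
    (ν : Measure Y) (α : ℝ) : ℝ≥0∞ :=
  ⨅ π : FiniteMeasure (X × Y), uotObjective c Ψ₁ Ψ₂ μ ν α π

/-- The set of optimal plans of the `α`-scaled unbalanced problem. -/
def uotPlans (c : X × Y → ℝ≥0) (Ψ₁ Ψ₂ : ℝ → ℝ≥0∞) (μ : Measure X)
    (ν : Measure Y) (α : ℝ) : Set (FiniteMeasure (X × Y)) :=
  {π | uotObjective c Ψ₁ Ψ₂ μ ν α π = uotValue c Ψ₁ Ψ₂ μ ν α}

end UOT

namespace UOT

/-! The proof is a compactness argument of Dini type. The objectives `F_α` increase in `α`. Each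
`Ψ_i` vanishes exactly at `1`, so on couplings `F_α` is the transport cost, and optimal unbalanced
plans satisfy `F_α ≤ C(μ, ν)`. Off the set of optimal balanced plans, `F_n` eventually exceeds `C(μ,
ν)`: a bounded penalty multiplied by every `n` must vanish, which forces the marginals to be `μ` and
`ν`. If `F_α` is weakly lower semicontinuous, the sets `{F_n > C(μ, ν)}` form an increasing open
cover of the compact set of plans of bounded mass outside `U`, so a single `n` suffices
(`eventually_uotPlans_subset`).

The main work is the lower semicontinuity of the divergence (`lowerSemicontinuous_csiszarDiv`). By
duality, `D_Ψ(ρ|μ)` is the supremum of `∫ φ dρ - ∫ ψ dμ` over bounded continuous `φ, ψ` for which `y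
↦ φ(z) y - ψ(z)` lies below `Ψ` on `[0, ∞)` for every `z` (`exists_boundedContinuous_gt`). Each such
functional is weakly continuous in `ρ`. -/

variable {Ψ : ℝ → ℝ≥0∞}

/-! ### Zeros of a normalized entropy function. -/

/-- The Fenchel–Young inequality, in real numbers. -/
theorem mul_sub_toReal_le_conjugate {x y : ℝ} (hx : conjugate Ψ x ≠ ⊤) (hy : Ψ y ≠ ⊤) :
    x * y - (Ψ y).toReal ≤ (conjugate Ψ x).toReal := by
  have h : ((x * y - (Ψ y).toReal : ℝ) : EReal) ≤ conjugate Ψ x := by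
    refine le_trans (le_of_eq ?_) (le_iSup _ y)
    rw [EReal.coe_sub, EReal.coe_ennreal_toReal hy]
  have hb : conjugate Ψ x ≠ ⊥ := fun hb => by
    rw [hb] at h
    exact (EReal.coe_ne_bot _) (le_bot_iff.1 h)
  rw [← EReal.coe_toReal hx hb] at h
  exact_mod_cast h

/-- By Fenchel–Young, `Ψ*(x) - x y ≥ 0` near `0` with equality at `0`, so the derivative `1 - y`
vanishes there. -/
theorem IsNormalized.eq_one_of_eq_zero (hn : IsNormalized Ψ) {y : ℝ} (hy : Ψ y = 0) : y = 1 := by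
  have hmin : IsLocalMin (fun x : ℝ => (conjugate Ψ x).toReal - x * y) 0 := by
    filter_upwards [hn.conjugate_ne_top] with x hx
    have := mul_sub_toReal_le_conjugate (y := y) hx (by simp [hy])
    simp only [hn.conjugate_zero, hy, ENNReal.toReal_zero, EReal.toReal_zero] at this ⊢
    linarith
  have hd := hn.hasDerivAt_conjugate.sub ((hasDerivAt_id (0 : ℝ)).mul_const y)
  have := hmin.hasDerivAt_eq_zero hd
  linarith

theorem IsNormalized.exists_lt (hn : IsNormalized Ψ) {ε : ℝ≥0∞} (hε : 0 < ε) :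
    ∃ y, Ψ y < ε := by
  by_contra! h
  have h1 : conjugate Ψ 0 ≤ -(ε : EReal) := by
    refine iSup_le fun y => ?_
    simp only [zero_mul, EReal.coe_zero, zero_sub]
    exact EReal.neg_le_neg_iff.2 (by exact_mod_cast h y)
  rw [hn.conjugate_zero, EReal.le_neg, neg_zero] at h1
  have : ε ≤ 0 := by exact_mod_cast h1
  exact absurd hε (not_lt.2 this)

/-- Since `Ψ*(0) = -inf Ψ`, the infimum is `0`. It is attained because finiteness of `Ψ*` at some `δ
> 0` bounds the sublevel set `{Ψ < 1}`, and the only possible zero is `1`. -/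
theorem IsNormalized.apply_one (hn : IsNormalized Ψ) (hΨ : IsEntropyFunction Ψ) : Ψ 1 = 0 := by
  obtain ⟨δ, hδ, hδt⟩ : ∃ δ : ℝ, 0 < δ ∧ conjugate Ψ δ ≠ ⊤ := by
    have h1 : ∀ᶠ x in 𝓝[>] (0 : ℝ), conjugate Ψ x ≠ ⊤ :=
      hn.conjugate_ne_top.filter_mono nhdsWithin_le_nhds
    obtain ⟨x, hx, hx0⟩ := (h1.and self_mem_nhdsWithin).exists
    exact ⟨x, hx0, hx⟩
  set B := ((conjugate Ψ δ).toReal + 1) / δ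
  have hB : ∀ y, Ψ y < 1 → y ∈ Icc 0 B := by
    intro y hy
    have hyt : Ψ y ≠ ⊤ := (hy.trans ENNReal.one_lt_top).ne
    refine ⟨not_lt.1 fun h => hyt (hΨ.eq_top_of_neg y h), ?_⟩
    have h1 := mul_sub_toReal_le_conjugate hδt hyt
    have h2 : (Ψ y).toReal ≤ 1 := by
      simpa using ENNReal.toReal_mono ENNReal.one_ne_top hy.le
    rw [le_div_iff₀ hδ]
    linarith
  obtain ⟨y₀, hy₀⟩ := hn.exists_lt zero_lt_one
  obtain ⟨y, -, hy⟩ := LowerSemicontinuousOn.exists_isMinOn (f := Ψ) ⟨y₀, hB y₀ hy₀⟩ isCompact_Icc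
    (hΨ.lowerSemicontinuous.lowerSemicontinuousOn _)
  have h0 : Ψ y = 0 := by
    by_contra h0
    obtain ⟨z, hz⟩ := hn.exists_lt (lt_min (pos_iff_ne_zero.2 h0) zero_lt_one)
    exact absurd (hy (hB z (hz.trans_le (min_le_right _ _)))) (not_le.2 (hz.trans_le (min_le_left _ _)))
  rwa [hn.eq_one_of_eq_zero h0] at h0

/-! ### Affine minorants and the recession constant. -/

/-- The pair `(a, b)` is an affine minorant of `Ψ` on the half-line: `a y - b ≤ Ψ y`. -/
def IsMinorant (Ψ : ℝ → ℝ≥0∞) (a b : ℝ) : Prop :=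
  ∀ y : ℝ, 0 ≤ y → ENNReal.ofReal (a * y - b) ≤ Ψ y

theorem IsMinorant.mono {a b a' b' : ℝ} (h : IsMinorant Ψ a b) (ha : a' ≤ a) (hb : b ≤ b') :
    IsMinorant Ψ a' b' := fun y hy =>
  (ENNReal.ofReal_le_ofReal (by nlinarith)).trans (h y hy)

theorem isMinorant_zero : IsMinorant Ψ 0 0 := fun y _ => by simp

theorem IsEntropyFunction.convexOn_toReal (hΨ : IsEntropyFunction Ψ) :
    ConvexOn ℝ {z | Ψ z ≠ ⊤} fun z => (Ψ z).toReal := by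
  have key : ∀ ⦃x⦄, Ψ x ≠ ⊤ → ∀ ⦃y⦄, Ψ y ≠ ⊤ → ∀ ⦃a b : ℝ⦄, 0 ≤ a → 0 ≤ b → a + b = 1 →
      Ψ (a • x + b • y) ≤ ENNReal.ofReal (a * (Ψ x).toReal + b * (Ψ y).toReal) := by
    intro x hx y hy a b ha hb hab
    have := hΨ.convexOn.2 (mem_univ x) (mem_univ y)
      (zero_le (a := (⟨a, ha⟩ : ℝ≥0))) (zero_le (a := (⟨b, hb⟩ : ℝ≥0))) (NNReal.eq hab)
    refine this.trans (le_of_eq ?_)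
    rw [ENNReal.ofReal_add (by positivity) (by positivity), ENNReal.ofReal_mul ha,
      ENNReal.ofReal_mul hb, ENNReal.ofReal_toReal hx, ENNReal.ofReal_toReal hy,
      ENNReal.ofReal_eq_coe_nnreal ha, ENNReal.ofReal_eq_coe_nnreal hb]
    rfl
  refine ⟨fun x hx y hy a b ha hb hab =>
    ne_top_of_le_ne_top ENNReal.ofReal_ne_top (key hx hy ha hb hab),
    fun x hx y hy a b ha hb hab => ?_⟩
  exact ENNReal.toReal_le_of_le_ofReal (by positivity) (key hx hy ha hb hab)

/-- Existence of a tangent line at a positive point. -/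
theorem IsEntropyFunction.exists_tangent (hΨ : IsEntropyFunction Ψ)
    (hf : ∀ x ∈ Ioi (0 : ℝ), Ψ x ≠ ⊤) {y : ℝ} (hy : 0 < y) :
    ∃ a b : ℝ, IsMinorant Ψ a b ∧ a * y - b = (Ψ y).toReal := by
  have hc := hΨ.convexOn_toReal
  have hint : y ∈ interior {z | Ψ z ≠ ⊤} :=
    mem_interior.2 ⟨Ioi 0, hf, isOpen_Ioi, hy⟩
  set f : ℝ → ℝ := fun z => (Ψ z).toReal with hfdef
  -- The right derivative of a convex function is a subgradient: it dominates all slopes from the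
  -- left and is dominated by all slopes to the right.
  set a := derivWithin f (Ioi y) y
  refine ⟨a, a * y - f y, fun z hz => ?_, by ring⟩
  by_cases hzt : Ψ z = ⊤
  · simp [hzt]
  refine ENNReal.ofReal_le_of_le_toReal ?_
  rcases lt_trichotomy z y with h | h | h
  · have h1 := (hc.slope_le_leftDeriv_of_mem_interior hzt hint h).trans
      (hc.leftDeriv_le_rightDeriv_of_mem_interior hint)
    rw [slope_def_field, div_le_iff₀ (by linarith)] at h1
    change _ ≤ f z
    linarith
  · subst h; change _ ≤ f z; linarith
  · have h1 := hc.rightDeriv_le_slope_of_mem_interior hint hzt h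
    rw [slope_def_field, le_div_iff₀ (by linarith)] at h1
    change _ ≤ f z
    linarith



/-- For `y > 0` the tangent at `y` works. At `y = 0` there may be no tangent, so one is taken at a
nearby `q ∈ (0, 1)`: it is nonpositive at `1` and nonnegative at `q`, hence non-increasing, and its
value at `0` is at least `Ψ q`. -/
theorem exists_minorant_gt (hΨ : IsEntropyFunction Ψ) (hn : IsNormalized Ψ)
    (hf : ∀ x ∈ Ioi (0 : ℝ), Ψ x ≠ ⊤) {y : ℝ} (hy : 0 ≤ y) {L : ℝ≥0∞} (hL : L < Ψ y) :
    ∃ a b : ℝ, IsMinorant Ψ a b ∧ L < ENNReal.ofReal (a * y - b) := by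
  rcases hy.eq_or_lt with rfl | hy
  · have h1 : ∀ᶠ q in 𝓝[>] (0 : ℝ), L < Ψ q :=
      (hΨ.lowerSemicontinuous 0 L hL).filter_mono nhdsWithin_le_nhds
    have h2 : ∀ᶠ q in 𝓝[>] (0 : ℝ), q ∈ Ioo (0 : ℝ) 1 := Ioo_mem_nhdsGT one_pos
    obtain ⟨q, hLq, hq0, hq1⟩ := (h1.and h2).exists
    obtain ⟨a, b, hab, habq⟩ := hΨ.exists_tangent hf hq0
    refine ⟨a, b, hab, ?_⟩
    have h3 := hab 1 zero_le_one
    rw [hn.apply_one hΨ, nonpos_iff_eq_zero, ENNReal.ofReal_eq_zero] at h3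
    have h4 : (0 : ℝ) ≤ (Ψ q).toReal := ENNReal.toReal_nonneg
    rw [← ENNReal.ofReal_toReal (hf q hq0)] at hLq
    refine hLq.trans_le (ENNReal.ofReal_le_ofReal ?_)
    have : a ≤ 0 := by nlinarith
    nlinarith
  · obtain ⟨a, b, hab, haby⟩ := hΨ.exists_tangent hf hy
    exact ⟨a, b, hab, by rwa [haby, ENNReal.ofReal_toReal (hf y hy)]⟩

/-- The tangent at `y > 1` is nonpositive at `1` because `Ψ 1 = 0`. Hence `b ≥ a ≥ 0`, and its slope
is at least `Ψ y / y`. -/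
theorem exists_minorant_slope_gt (hΨ : IsEntropyFunction Ψ) (hn : IsNormalized Ψ)
    (hf : ∀ x ∈ Ioi (0 : ℝ), Ψ x ≠ ⊤) {L : ℝ≥0∞} (hL : L < recession Ψ) :
    ∃ a b : ℝ, IsMinorant Ψ a b ∧ L < ENNReal.ofReal a := by
  have h1 : ∃ᶠ y : ℝ in atTop, L < Ψ y / ENNReal.ofReal y :=
    frequently_lt_of_lt_limsup (by isBoundedDefault) hL
  obtain ⟨y, hy, hy1⟩ := (h1.and_eventually (eventually_gt_atTop (1 : ℝ))).exists
  have hy0 : 0 < y := one_pos.trans hy1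
  obtain ⟨a, b, hab, haby⟩ := hΨ.exists_tangent hf hy0
  refine ⟨a, b, hab, hy.trans_le ?_⟩
  have h3 := hab 1 zero_le_one
  rw [hn.apply_one hΨ, nonpos_iff_eq_zero, ENNReal.ofReal_eq_zero] at h3
  have h4 : (0 : ℝ) ≤ (Ψ y).toReal := ENNReal.toReal_nonneg
  rw [← ENNReal.ofReal_toReal (hf y hy0), ← ENNReal.ofReal_div_of_pos hy0]
  refine ENNReal.ofReal_le_ofReal ?_
  rw [div_le_iff₀ hy0]
  have : 0 ≤ a := by nlinarith
  nlinarith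

theorem IsMinorant.le_recession {a b : ℝ} (h : IsMinorant Ψ a b) :
    ENNReal.ofReal a ≤ recession Ψ := by
  have h1 : Tendsto (fun y : ℝ => ENNReal.ofReal (a - b / y)) atTop (𝓝 (ENNReal.ofReal a)) := by
    refine (ENNReal.continuous_ofReal.tendsto _).comp ?_
    simpa using (tendsto_const_nhds (x := a)).sub (tendsto_id.const_div_atTop b)
  rw [← h1.limsup_eq]
  refine limsup_le_limsup ?_
  filter_upwards [eventually_gt_atTop (0 : ℝ)] with y hy
  have : a - b / y = (a * y - b) / y := by field_simp
  rw [this, ENNReal.ofReal_div_of_pos hy]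
  exact ENNReal.div_le_div_right (h y hy.le) _

theorem exists_minorant_slope_pos (hΨ : IsEntropyFunction Ψ) (hn : IsNormalized Ψ)
    (hf : ∀ x ∈ Ioi (0 : ℝ), Ψ x ≠ ⊤) : ∃ a b : ℝ, IsMinorant Ψ a b ∧ 0 < a := by
  obtain ⟨a, b, hab, hab2⟩ := hΨ.exists_tangent hf two_pos
  have h3 := hab 1 zero_le_one
  rw [hn.apply_one hΨ, nonpos_iff_eq_zero, ENNReal.ofReal_eq_zero] at h3
  have h4 : (0 : ℝ) < (Ψ 2).toReal := by
    refine ENNReal.toReal_pos (fun h => ?_) (hf 2 (mem_Ioi.2 two_pos))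
    have := hn.eq_one_of_eq_zero h
    norm_num at this
  exact ⟨a, b, hab, by linarith⟩

/-- Decreasing `a` and increasing `b` keeps a minorant, so there is room for rationals. The weights
`(u, v) = (y, 1)` give values at `y`, and `(1, 0)` gives slopes. -/
theorem IsMinorant.exists_rat {a b u v : ℝ} (h : IsMinorant Ψ a b)
    {L : ℝ≥0∞} (hL : L < ENNReal.ofReal (a * u - b * v)) :
    ∃ a' b' : ℚ, IsMinorant Ψ a' b' ∧ L < ENNReal.ofReal (a' * u - b' * v) := by
  have hcont : Continuous fun p : ℝ × ℝ => ENNReal.ofReal (p.1 * u - p.2 * v) :=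
    ENNReal.continuous_ofReal.comp (by fun_prop)
  have hev : ∀ᶠ p : ℝ × ℝ in 𝓝 (a, b), L < ENNReal.ofReal (p.1 * u - p.2 * v) :=
    (hcont.tendsto (a, b)).eventually_const_lt hL
  rw [nhds_prod_eq] at hev
  obtain ⟨P, hP, Q, hQ, hPQ⟩ := Filter.eventually_prod_iff.1 hev
  have hP' : ∀ᶠ x in 𝓝[<] a, P x := hP.filter_mono nhdsWithin_le_nhds
  have hQ' : ∀ᶠ x in 𝓝[>] b, Q x := hQ.filter_mono nhdsWithin_le_nhds
  obtain ⟨l, hl, hl'⟩ := (mem_nhdsLT_iff_exists_Ioo_subset).1 hP'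
  obtain ⟨r, hr, hr'⟩ := (mem_nhdsGT_iff_exists_Ioo_subset).1 hQ'
  obtain ⟨a', ha1, ha2⟩ := exists_rat_btwn (mem_Iio.1 hl)
  obtain ⟨b', hb1, hb2⟩ := exists_rat_btwn (mem_Ioi.1 hr)
  exact ⟨a', b', h.mono ha2.le hb1.le, hPQ (hl' ⟨ha1, ha2⟩) (hr' ⟨hb1, hb2⟩)⟩

/-- An entropy function is a countable supremum of affine minorants, with the recession constant the
supremum of the slopes. -/
theorem exists_minorant_seq (hΨ : IsEntropyFunction Ψ) (hn : IsNormalized Ψ)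
    (hf : ∀ x ∈ Ioi (0 : ℝ), Ψ x ≠ ⊤) :
    ∃ a b : ℕ → ℝ, a 0 = 0 ∧ b 0 = 0 ∧ (∀ k, IsMinorant Ψ (a k) (b k)) ∧
      (∀ y, 0 ≤ y → ⨆ k, ENNReal.ofReal (a k * y - b k) = Ψ y) ∧
      ⨆ k, ENNReal.ofReal (a k) = recession Ψ := by
  set T : Set (ℚ × ℚ) := {p | IsMinorant Ψ p.1 p.2}
  have hT : T.Nonempty := ⟨(0, 0), by simpa [T] using isMinorant_zero⟩
  obtain ⟨g, hg⟩ := (to_countable T).exists_eq_range hT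
  have hgT : ∀ k, IsMinorant Ψ (g k).1 (g k).2 := fun k => by
    have : g k ∈ T := hg ▸ mem_range_self k
    exact this
  -- The zero minorant is put at index `0`, so that maxima over initial segments are nonnegative.
  have hmem : ∀ k, IsMinorant Ψ (Nat.casesOn k 0 fun k => ((g k).1 : ℝ))
      (Nat.casesOn k 0 fun k => ((g k).2 : ℝ)) := by
    rintro (_ | k)
    · exact isMinorant_zero
    · exact hgT k
  refine ⟨fun k => Nat.casesOn k 0 fun k => ((g k).1 : ℝ),
    fun k => Nat.casesOn k 0 fun k => ((g k).2 : ℝ), rfl, rfl, hmem, fun y hy => ?_, ?_⟩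
  · refine le_antisymm (iSup_le fun k => hmem k y hy) (le_of_forall_lt fun L hL => ?_)
    obtain ⟨a, b, hab, hL'⟩ := exists_minorant_gt hΨ hn hf hy hL
    obtain ⟨a', b', hab', hL''⟩ := hab.exists_rat (v := 1) (by simpa using hL')
    have : (a', b') ∈ range g := hg ▸ hab'
    obtain ⟨k, hk⟩ := this
    refine lt_iSup_iff.2 ⟨k + 1, ?_⟩
    simpa [hk] using hL''
  · refine le_antisymm (iSup_le fun k => (hmem k).le_recession) (le_of_forall_lt fun L hL => ?_)
    obtain ⟨a, b, hab, hL'⟩ := exists_minorant_slope_gt hΨ hn hf hL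
    obtain ⟨a', b', hab', hL''⟩ := hab.exists_rat (u := 1) (v := 0) (by simpa using hL')
    have : (a', b') ∈ range g := hg ▸ hab'
    obtain ⟨k, hk⟩ := this
    refine lt_iSup_iff.2 ⟨k + 1, ?_⟩
    simpa [hk] using hL''

open scoped BoundedContinuousFunction

/-! ### Duality with measurable selections of minorants. -/

section Duality

variable {Z : Type*} [MeasurableSpace Z]

theorem ofReal_integral_le_lintegral_ofReal {m : Measure Z} {f : Z → ℝ} (hf : Integrable f m) :
    ENNReal.ofReal (∫ z, f z ∂m) ≤ ∫⁻ z, ENNReal.ofReal (f z) ∂m := by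
  have h1 : ∫ z, f z ∂m ≤ ∫ z, max (f z) 0 ∂m :=
    integral_mono hf hf.pos_part fun z => le_max_left _ _
  refine (ENNReal.ofReal_le_ofReal h1).trans (le_of_eq ?_)
  rw [ofReal_integral_eq_lintegral_ofReal hf.pos_part (ae_of_all _ fun z => le_max_right _ _)]
  simp [ENNReal.ofReal_max]

theorem integrable_mul_rnDeriv {ρ μ : Measure Z} [IsFiniteMeasure ρ] [IsFiniteMeasure μ]
    {φ : Z → ℝ} (hφ : Integrable φ ρ) :
    Integrable (fun z => φ z * (ρ.rnDeriv μ z).toReal) μ := by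
  have h : Integrable φ (μ.withDensity (ρ.rnDeriv μ)) :=
    hφ.mono_measure (Measure.withDensity_rnDeriv_le ρ μ)
  rw [integrable_withDensity_iff_integrable_smul' (Measure.measurable_rnDeriv ρ μ)
    (Measure.rnDeriv_lt_top ρ μ)] at h
  simpa [mul_comm] using h

theorem integral_sub_integral_eq {ρ μ : Measure Z} [IsFiniteMeasure ρ] [IsFiniteMeasure μ]
    {φ ψ : Z → ℝ} (hφ : Integrable φ ρ) (hψ : Integrable ψ μ) :
    ∫ z, φ z ∂ρ - ∫ z, ψ z ∂μ =
      ∫ z, φ z ∂(ρ.singularPart μ) + ∫ z, (φ z * (ρ.rnDeriv μ z).toReal - ψ z) ∂μ := by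
  have h1 : ∫ z, φ z ∂ρ = ∫ z, φ z ∂(ρ.singularPart μ) +
      ∫ z, φ z * (ρ.rnDeriv μ z).toReal ∂μ := by
    conv_lhs => rw [← Measure.singularPart_add_rnDeriv ρ μ]
    rw [integral_add_measure (hφ.mono_measure (Measure.singularPart_le ρ μ))
      (hφ.mono_measure (Measure.withDensity_rnDeriv_le ρ μ)),
      integral_withDensity_eq_integral_toReal_smul (Measure.measurable_rnDeriv ρ μ)
      (Measure.rnDeriv_lt_top ρ μ)]
    simp [mul_comm]
  rw [integral_sub (integrable_mul_rnDeriv hφ) hψ, h1]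
  ring

/-- Pointwise affine minorants of `Ψ` bound the Csiszár divergence from below. -/
theorem ofReal_integral_sub_le_csiszarDiv {ρ μ : Measure Z} [IsFiniteMeasure ρ]
    [IsFiniteMeasure μ] {φ ψ : Z → ℝ} (hφ : Integrable φ ρ) (hψ : Integrable ψ μ)
    (h : ∀ z, IsMinorant Ψ (φ z) (ψ z)) :
    ENNReal.ofReal (∫ z, φ z ∂ρ - ∫ z, ψ z ∂μ) ≤ csiszarDiv Ψ ρ μ := by
  rw [integral_sub_integral_eq hφ hψ, add_comm]
  refine ENNReal.ofReal_add_le.trans (add_le_add ?_ ?_)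
  · refine (ofReal_integral_le_lintegral_ofReal ((integrable_mul_rnDeriv hφ).sub hψ)).trans ?_
    exact lintegral_mono fun z => h z _ ENNReal.toReal_nonneg
  · refine (ofReal_integral_le_lintegral_ofReal
      (hφ.mono_measure (Measure.singularPart_le ρ μ))).trans ?_
    refine (lintegral_mono fun z => (h z).le_recession).trans ?_
    simp

theorem exists_measurable_argmax {g : ℕ → Z → ℝ} (hg : ∀ k, Measurable (g k)) :
    ∃ κ : ℕ → Z → ℕ, (∀ N, Measurable (κ N)) ∧ (∀ N z, κ N z ≤ N) ∧
      ∀ N z k, k ≤ N → g k z ≤ g (κ N z) z := by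
  suffices ∀ N, ∃ κ : Z → ℕ, Measurable κ ∧ (∀ z, κ z ≤ N) ∧ ∀ z k, k ≤ N → g k z ≤ g (κ z) z by
    choose κ h using this
    exact ⟨κ, fun N => (h N).1, fun N => (h N).2.1, fun N => (h N).2.2⟩
  intro N
  induction N with
  | zero =>
    refine ⟨fun _ => 0, measurable_const, fun _ => le_rfl, fun z k hk => ?_⟩
    rw [Nat.le_zero.1 hk]
  | succ N ih =>
    obtain ⟨κ, hκ, hκN, hmax⟩ := ih
    classical
    have hgκ : Measurable fun z => g (κ z) z :=
      (measurable_from_prod_countable_right (f := fun p : ℕ × Z => g p.1 p.2) hg).comp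
        (hκ.prodMk measurable_id)
    refine ⟨fun z => if g (κ z) z < g (N + 1) z then N + 1 else κ z,
      Measurable.ite (measurableSet_lt hgκ (hg _)) measurable_const hκ, fun z => ?_,
      fun z k hk => ?_⟩
    · dsimp only
      split_ifs
      · exact le_rfl
      · exact (hκN z).trans N.le_succ
    · dsimp only
      rcases Nat.le_succ_iff.1 hk with hk | rfl <;> split_ifs with hlt
      · exact (hmax z k hk).trans hlt.le
      · exact hmax z k hk
      · exact le_rfl
      · exact not_lt.1 hlt

/-- The Csiszár divergence is approximated by finite-valued measurable selections of affine
minorants. -/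
theorem exists_selection_gt {a b : ℕ → ℝ} (ha0 : a 0 = 0) (hb0 : b 0 = 0)
    (hsup : ∀ y, 0 ≤ y → ⨆ k, ENNReal.ofReal (a k * y - b k) = Ψ y)
    (hrec : ⨆ k, ENNReal.ofReal (a k) = recession Ψ)
    (ρ μ : Measure Z) [IsFiniteMeasure ρ] [IsFiniteMeasure μ] {L : ℝ≥0∞}
    (hL : L < csiszarDiv Ψ ρ μ) :
    ∃ (N : ℕ) (κ : Z → ℕ), Measurable κ ∧ (∀ z, κ z ≤ N) ∧
      L < ENNReal.ofReal (∫ z, a (κ z) ∂ρ - ∫ z, b (κ z) ∂μ) := by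
  classical
  have hsing := Measure.mutuallySingular_singularPart ρ μ
  set S := hsing.nullSet
  have hS : MeasurableSet S := hsing.measurableSet_nullSet
  have hSμ : ∀ᵐ z ∂μ, z ∈ S := by
    rw [ae_iff]; exact hsing.measure_compl_nullSet
  have hSs : ∀ᵐ z ∂(ρ.singularPart μ), z ∉ S := by
    rw [ae_iff]; simp only [not_not]; exact hsing.measure_nullSet
  set r : Z → ℝ := fun z => (ρ.rnDeriv μ z).toReal
  have hr : Measurable r := (Measure.measurable_rnDeriv ρ μ).ennreal_toReal
  -- `S` carries `μ` and its complement carries the singular part. The divergence is therefore one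
  -- integral of `⨆ k, g k` against `μ + ρ^⊥`: values on `S`, slopes off `S`.
  set g : ℕ → Z → ℝ := fun k z => if z ∈ S then a k * r z - b k else a k with hgdef
  have hg : ∀ k, Measurable (g k) := fun k =>
    Measurable.ite hS ((hr.const_mul _).sub_const _) measurable_const
  obtain ⟨κ, hκ, hκN, hmax⟩ := exists_measurable_argmax hg
  have hgκ : ∀ N, Measurable fun z => g (κ N z) z := fun N =>
    (measurable_from_prod_countable_right (f := fun p : ℕ × Z => g p.1 p.2) hg).comp
      ((hκ N).prodMk measurable_id)
  have hmono : Monotone fun N z => ENNReal.ofReal (g (κ N z) z) := fun M N hMN z =>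
    ENNReal.ofReal_le_ofReal (hmax N z _ ((hκN M z).trans hMN))
  have hiSup : ∀ z, ⨆ N, ENNReal.ofReal (g (κ N z) z) = ⨆ k, ENNReal.ofReal (g k z) := fun z =>
    le_antisymm (iSup_le fun N => le_iSup (fun k => ENNReal.ofReal (g k z)) _)
      (iSup_mono fun N => ENNReal.ofReal_le_ofReal (hmax N z N le_rfl))
  have hdiv : csiszarDiv Ψ ρ μ =
      ⨆ N, ∫⁻ z, ENNReal.ofReal (g (κ N z) z) ∂(μ + ρ.singularPart μ) := by
    rw [← lintegral_iSup (fun N => (hgκ N).ennreal_ofReal) hmono, lintegral_add_measure, csiszarDiv]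
    congr 1
    · refine lintegral_congr_ae ?_
      filter_upwards [hSμ] with z hz
      rw [hiSup, ← hsup _ ENNReal.toReal_nonneg]
      simp [hgdef, hz, r]
    · rw [← lintegral_const]
      refine lintegral_congr_ae ?_
      filter_upwards [hSs] with z hz
      rw [hiSup, ← hrec]
      simp [hgdef, hz]
  rw [hdiv] at hL
  obtain ⟨N, hN⟩ := lt_iSup_iff.1 hL
  refine ⟨N, κ N, hκ N, hκN N, hN.trans_eq ?_⟩
  have hint : ∀ (d : ℕ → ℝ) (m : Measure Z) [IsFiniteMeasure m],
      Integrable (fun z => d (κ N z)) m := fun d m _ => by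
    refine Integrable.of_bound
      ((measurable_from_nat (f := d)).comp (hκ N)).aestronglyMeasurable
      (∑ k ∈ Finset.range (N + 1), |d k|) (ae_of_all _ fun z => ?_)
    exact Finset.single_le_sum (f := fun k => |d k|) (fun k _ => abs_nonneg _)
      (Finset.mem_range.2 (Nat.lt_succ_of_le (hκN N z)))
  -- The competitor of index `0` is the zero minorant, so `ENNReal.ofReal` truncates nothing.
  have hpos : ∀ z, 0 ≤ g (κ N z) z := fun z => by
    refine le_trans (le_of_eq ?_) (hmax N z 0 (Nat.zero_le _))
    simp [hgdef, ha0, hb0]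
  have hgμ : (fun z => g (κ N z) z) =ᵐ[μ] fun z => a (κ N z) * r z - b (κ N z) := by
    filter_upwards [hSμ] with z hz
    simp [hgdef, hz]
  have hgs : (fun z => g (κ N z) z) =ᵐ[ρ.singularPart μ] fun z => a (κ N z) := by
    filter_upwards [hSs] with z hz
    simp [hgdef, hz]
  have hintμ : Integrable (fun z => g (κ N z) z) μ :=
    ((integrable_mul_rnDeriv (hint a ρ)).sub (hint b μ)).congr hgμ.symm
  have hints : Integrable (fun z => g (κ N z) z) (ρ.singularPart μ) := (hint a _).congr hgs.symm
  rw [lintegral_add_measure, integral_sub_integral_eq (hint a ρ) (hint b μ),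
    ← integral_congr_ae hgμ, ← integral_congr_ae hgs,
    ENNReal.ofReal_add (integral_nonneg hpos) (integral_nonneg hpos),
    ofReal_integral_eq_lintegral_ofReal hintμ (ae_of_all _ hpos),
    ofReal_integral_eq_lintegral_ofReal hints (ae_of_all _ hpos), add_comm]

end Duality

/-! ### Continuous interpolation between minorants. -/

/-- The hat function `max 0 (1 - |t|)`. -/
noncomputable def hat (t : ℝ) : ℝ := max 0 (1 - |t|)

theorem hat_nonneg (t : ℝ) : 0 ≤ hat t := le_max_left _ _

theorem continuous_hat : Continuous hat := by unfold hat; fun_prop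

theorem hat_natCast_sub_natCast (j k : ℕ) : hat ((j : ℝ) - k) = if k = j then 1 else 0 := by
  split_ifs with h
  · simp [h, hat]
  · refine max_eq_left ?_
    have h1 : (1 : ℤ) ≤ |(j : ℤ) - k| := Int.one_le_abs (by omega)
    have h2 : (1 : ℝ) ≤ |(j : ℝ) - k| := by exact_mod_cast h1
    linarith

/-- The second bound carries the induction: for `N - 1 ≤ t ≤ N` the hat at `N` contributes `1 - (N -
t)`, so the earlier hats must leave at most `N - t`. -/
theorem sum_hat_le (N : ℕ) (t : ℝ) :
    ∑ k ∈ Finset.range N, hat (t - k) ≤ 1 ∧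
      ∑ k ∈ Finset.range N, hat (t - k) ≤ max 0 (N - t) := by
  induction N with
  | zero => simp
  | succ N ih =>
    rw [Finset.sum_range_succ]
    obtain ⟨h1, h2⟩ := ih
    push_cast
    unfold hat at *
    rcases le_total t (N - 1) with h | h
    · rw [abs_of_nonpos (by linarith : t - N ≤ 0),
        max_eq_left (by linarith : 1 - -(t - N) ≤ 0), max_eq_right (by linarith)]
      constructor <;> linarith
    rcases le_total t N with h' | h'
    · rw [abs_of_nonpos (by linarith : t - N ≤ 0),
        max_eq_right (by linarith : 0 ≤ 1 - -(t - N)), max_eq_right (by linarith)]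
      rw [max_eq_right (by linarith)] at h2
      constructor <;> linarith
    · rw [abs_of_nonneg (by linarith : 0 ≤ t - N)]
      rw [max_eq_left (by linarith)] at h2
      have h3 : max 0 (1 - (t - N)) ≤ 1 := max_le zero_le_one (by linarith)
      have h4 : max 0 (1 - (t - (N : ℝ))) = max 0 (N + 1 - t) := by congr 1; ring
      constructor <;> linarith

/-- The path that interpolates `d 0, …, d N` piecewise linearly at the integers `0, …, N`. -/
noncomputable def hatPath (d : ℕ → ℝ) (N : ℕ) (t : ℝ) : ℝ :=
  ∑ k ∈ Finset.range (N + 1), hat (t - k) * d k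

theorem continuous_hatPath (d : ℕ → ℝ) (N : ℕ) : Continuous (hatPath d N) := by
  unfold hatPath
  have := continuous_hat
  fun_prop

theorem hatPath_natCast (d : ℕ → ℝ) {N j : ℕ} (hj : j ≤ N) : hatPath d N j = d j := by
  simp only [hatPath, hat_natCast_sub_natCast, ite_mul, one_mul, zero_mul]
  rw [Finset.sum_ite_eq' (Finset.range (N + 1)) j]
  simp [Nat.lt_succ_of_le hj]

theorem norm_hatPath_le (d : ℕ → ℝ) (N : ℕ) (t : ℝ) :
    ‖hatPath d N t‖ ≤ ∑ k ∈ Finset.range (N + 1), |d k| := by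
  refine (norm_sum_le _ _).trans (Finset.sum_le_sum fun k _ => ?_)
  rw [norm_mul, Real.norm_eq_abs, Real.norm_eq_abs, abs_of_nonneg (hat_nonneg _)]
  refine mul_le_of_le_one_left (abs_nonneg _) (max_le zero_le_one ?_)
  linarith [abs_nonneg (t - k)]

/-- Weights of total at most `1` are enough, since `Ψ ≥ 0`. Thus any real parameter `t`, not only an
integer index, yields a minorant. -/
theorem isMinorant_hatPath {a b : ℕ → ℝ} (h : ∀ k, IsMinorant Ψ (a k) (b k)) (N : ℕ) (t : ℝ) :
    IsMinorant Ψ (hatPath a N t) (hatPath b N t) := by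
  intro y hy
  by_cases ht : Ψ y = ⊤
  · simp [ht]
  refine ENNReal.ofReal_le_of_le_toReal ?_
  have h1 : ∀ k, a k * y - b k ≤ (Ψ y).toReal := fun k =>
    (ENNReal.ofReal_le_iff_le_toReal ht).1 (h k y hy)
  calc hatPath a N t * y - hatPath b N t
      = ∑ k ∈ Finset.range (N + 1), hat (t - k) * (a k * y - b k) := by
        simp only [hatPath, Finset.sum_mul, ← Finset.sum_sub_distrib]
        exact Finset.sum_congr rfl fun k _ => by ring
    _ ≤ ∑ k ∈ Finset.range (N + 1), hat (t - k) * (Ψ y).toReal :=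
        Finset.sum_le_sum fun k _ => mul_le_mul_of_nonneg_left (h1 k) (hat_nonneg _)
    _ = (∑ k ∈ Finset.range (N + 1), hat (t - k)) * (Ψ y).toReal := by rw [Finset.sum_mul]
    _ ≤ (Ψ y).toReal :=
        mul_le_of_le_one_left ENNReal.toReal_nonneg (sum_hat_le _ t).1

/-! ### Duality with continuous functions and weak lower semicontinuity. -/

section Topology

variable {Z : Type*} [TopologicalSpace Z] [TopologicalSpace.PseudoMetrizableSpace Z]
  [MeasurableSpace Z] [BorelSpace Z]

/-- An integrable function is the almost everywhere limit of continuous functions. -/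
theorem exists_continuous_tendsto_ae (m : Measure Z) [IsFiniteMeasure m] {f : Z → ℝ}
    (hf : Integrable f m) :
    ∃ F : ℕ → Z → ℝ, (∀ n, Continuous (F n)) ∧
      ∀ᵐ z ∂m, Tendsto (fun n => F n z) atTop (𝓝 (f z)) := by
  have hex : ∀ n : ℕ, ∃ g : Z →ᵇ ℝ, eLpNorm (f - ⇑g) 1 m ≤ ((n : ℝ≥0∞) + 1)⁻¹ ∧ MemLp g 1 m :=
    fun n => (memLp_one_iff_integrable.2 hf).exists_boundedContinuous_eLpNorm_sub_le
      ENNReal.one_ne_top (by simp)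
  choose g hg _ using hex
  have hlim : Tendsto (fun n => eLpNorm (⇑(g n) - f) 1 m) atTop (𝓝 0) := by
    have h0 : Tendsto (fun n : ℕ => ((n : ℝ≥0∞) + 1)⁻¹) atTop (𝓝 0) := by
      simpa using (tendsto_add_atTop_iff_nat 1).2 ENNReal.tendsto_inv_nat_nhds_zero
    refine tendsto_of_tendsto_of_tendsto_of_le_of_le tendsto_const_nhds h0 (fun _ => zero_le)
      fun n => ?_
    rw [eLpNorm_sub_comm]
    exact hg n
  obtain ⟨ns, -, hns⟩ := (tendstoInMeasure_of_tendsto_eLpNorm one_ne_zero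
    (fun n => (g n).continuous.aestronglyMeasurable) hf.1 hlim).exists_seq_tendsto_ae
  exact ⟨fun n => g (ns n), fun n => (g (ns n)).continuous, hns⟩

/-- Convex duality for the Csiszár divergence: continuous functions suffice. -/
theorem exists_boundedContinuous_gt (hΨ : IsEntropyFunction Ψ) (hn : IsNormalized Ψ)
    (hf : ∀ x ∈ Ioi (0 : ℝ), Ψ x ≠ ⊤) (ρ μ : Measure Z) [IsFiniteMeasure ρ] [IsFiniteMeasure μ]
    {L : ℝ≥0∞} (hL : L < csiszarDiv Ψ ρ μ) :
    ∃ φ ψ : Z →ᵇ ℝ, (∀ z, IsMinorant Ψ (φ z) (ψ z)) ∧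
      L < ENNReal.ofReal (∫ z, φ z ∂ρ - ∫ z, ψ z ∂μ) := by
  obtain ⟨a, b, ha0, hb0, hmin, hsup, hrec⟩ := exists_minorant_seq hΨ hn hf
  obtain ⟨N, κ, hκ, hκN, hLκ⟩ := exists_selection_gt ha0 hb0 hsup hrec ρ μ hL
  have hκi : Integrable (fun z => (κ z : ℝ)) (ρ + μ) :=
    Integrable.of_bound ((measurable_from_nat (f := fun k => (k : ℝ))).comp hκ).aestronglyMeasurable
      N (ae_of_all _ fun z => by simpa using hκN z)
  -- The index `κ` itself is approximated by continuous functions. Composing with the interpolating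
  -- paths keeps the minorant property exactly and recovers `a ∘ κ`, `b ∘ κ` in the limit.
  obtain ⟨F, hF, hlim⟩ := exists_continuous_tendsto_ae (ρ + μ) hκi
  rw [ae_add_measure_iff] at hlim
  have hconv : ∀ (d : ℕ → ℝ) (m : Measure Z) [IsFiniteMeasure m],
      (∀ᵐ z ∂m, Tendsto (fun n => F n z) atTop (𝓝 (κ z : ℝ))) →
      Tendsto (fun n => ∫ z, hatPath d N (F n z) ∂m) atTop (𝓝 (∫ z, d (κ z) ∂m)) := by
    intro d m _ hm
    refine tendsto_integral_of_dominated_convergence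
      (fun _ => ∑ k ∈ Finset.range (N + 1), |d k|)
      (fun n => ((continuous_hatPath d N).comp (hF n)).aestronglyMeasurable) (integrable_const _)
      (fun n => ae_of_all _ fun z => norm_hatPath_le d N _) ?_
    filter_upwards [hm] with z hz
    have := ((continuous_hatPath d N).tendsto (κ z)).comp hz
    rwa [hatPath_natCast d (hκN z)] at this
  have hlim' := (ENNReal.continuous_ofReal.tendsto _).comp
    ((hconv a ρ hlim.1).sub (hconv b μ hlim.2))
  obtain ⟨n, hn⟩ := (hlim'.eventually_const_lt hLκ).exists
  exact ⟨BoundedContinuousFunction.ofNormedAddCommGroup (fun z => hatPath a N (F n z))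
      ((continuous_hatPath a N).comp (hF n)) _ fun z => norm_hatPath_le a N _,
    BoundedContinuousFunction.ofNormedAddCommGroup (fun z => hatPath b N (F n z))
      ((continuous_hatPath b N).comp (hF n)) _ fun z => norm_hatPath_le b N _,
    fun z => isMinorant_hatPath hmin N _, hn⟩

theorem lowerSemicontinuous_csiszarDiv (hΨ : IsEntropyFunction Ψ) (hn : IsNormalized Ψ)
    (hf : ∀ x ∈ Ioi (0 : ℝ), Ψ x ≠ ⊤) (μ : Measure Z) [IsFiniteMeasure μ] :
    LowerSemicontinuous fun ρ : FiniteMeasure Z => csiszarDiv Ψ (ρ : Measure Z) μ := by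
  intro ρ L hL
  obtain ⟨φ, ψ, hmin, hlt⟩ := exists_boundedContinuous_gt hΨ hn hf (ρ : Measure Z) μ hL
  have hcont : Continuous fun σ : FiniteMeasure Z =>
      ENNReal.ofReal (∫ z, φ z ∂(σ : Measure Z) - ∫ z, ψ z ∂μ) :=
    ENNReal.continuous_ofReal.comp
      ((FiniteMeasure.continuous_integral_boundedContinuousFunction φ).sub continuous_const)
  filter_upwards [(hcont.tendsto ρ).eventually_const_lt hlt] with σ hσ
  exact hσ.trans_le (ofReal_integral_sub_le_csiszarDiv (φ.integrable _) (ψ.integrable _) hmin)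

end Topology

/-! ### Zeros and coercivity of the divergence. -/

section Divergence

variable {Z : Type*} [MeasurableSpace Z]

theorem csiszarDiv_self (hΨ : IsEntropyFunction Ψ) (hn : IsNormalized Ψ) (μ : Measure Z)
    [IsFiniteMeasure μ] : csiszarDiv Ψ μ μ = 0 := by
  have h : ∫⁻ z, Ψ (μ.rnDeriv μ z).toReal ∂μ = 0 := by
    rw [← lintegral_zero (μ := μ)]
    refine lintegral_congr_ae ?_
    filter_upwards [μ.rnDeriv_self] with z hz
    simp [hz, hn.apply_one hΨ]
  simp [csiszarDiv, h]

/-- A positive recession constant kills the singular part, and the density is `1` almost everywhere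
because `Ψ` vanishes only at `1`. -/
theorem eq_of_csiszarDiv_eq_zero (hΨ : IsEntropyFunction Ψ) (hn : IsNormalized Ψ)
    (hf : ∀ x ∈ Ioi (0 : ℝ), Ψ x ≠ ⊤) {ρ μ : Measure Z} [IsFiniteMeasure ρ] [IsFiniteMeasure μ]
    (h : csiszarDiv Ψ ρ μ = 0) : ρ = μ := by
  rw [csiszarDiv, add_eq_zero, mul_eq_zero] at h
  obtain ⟨h1, h2⟩ := h
  have hrec : recession Ψ ≠ 0 := by
    obtain ⟨a, b, hab, ha⟩ := exists_minorant_slope_pos hΨ hn hf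
    exact ((ENNReal.ofReal_pos.2 ha).trans_le hab.le_recession).ne'
  have hs : ρ.singularPart μ = 0 := Measure.measure_univ_eq_zero.1 (h2.resolve_left hrec)
  have hmeas : Measurable fun z => Ψ (ρ.rnDeriv μ z).toReal :=
    hΨ.lowerSemicontinuous.measurable.comp (Measure.measurable_rnDeriv ρ μ).ennreal_toReal
  have h1' : ρ.rnDeriv μ =ᵐ[μ] fun _ => 1 := by
    filter_upwards [(lintegral_eq_zero_iff hmeas).1 h1] with z hz
    have := hn.eq_one_of_eq_zero hz
    rwa [ENNReal.toReal_eq_one_iff] at this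
  rw [← Measure.singularPart_add_rnDeriv ρ μ, hs, zero_add, withDensity_congr_ae h1']
  exact withDensity_one

/-- A constant minorant with slope `a > 0` gives `a ρ(Z) - b μ(Z) ≤ D_Ψ(ρ|μ)`. -/
theorem exists_measure_univ_le_of_csiszarDiv_le (hΨ : IsEntropyFunction Ψ) (hn : IsNormalized Ψ)
    (hf : ∀ x ∈ Ioi (0 : ℝ), Ψ x ≠ ⊤) (μ : Measure Z) [IsFiniteMeasure μ] {C : ℝ≥0∞} (hC : C ≠ ⊤) :
    ∃ M : ℝ≥0, ∀ ρ : Measure Z, IsFiniteMeasure ρ → csiszarDiv Ψ ρ μ ≤ C → ρ univ ≤ M := by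
  obtain ⟨a, b, hab, ha⟩ := exists_minorant_slope_pos hΨ hn hf
  refine ⟨((C.toReal + b * μ.real univ) / a).toNNReal, fun ρ _ hρ => ?_⟩
  have h1 := (ofReal_integral_sub_le_csiszarDiv (ρ := ρ) (μ := μ) (integrable_const a)
    (integrable_const b) fun _ => hab).trans hρ
  rw [ENNReal.ofReal_le_iff_le_toReal hC] at h1
  simp only [integral_const, smul_eq_mul] at h1
  rw [← ENNReal.ofReal_toReal (measure_ne_top ρ univ)]
  refine ENNReal.ofReal_le_ofReal ?_
  rw [le_div_iff₀ ha]
  change ρ.real univ * a ≤ _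
  linarith

end Divergence

/-! ### Couplings and the unbalanced objective. -/

section Plans

variable {X Y : Type*} [MeasurableSpace X] [MeasurableSpace Y] {c : X × Y → ℝ≥0} {Ψ₁ Ψ₂ : ℝ → ℝ≥0∞}

theorem couplings_nonempty (μ : Measure X) [IsProbabilityMeasure μ] (ν : Measure Y)
    [IsProbabilityMeasure ν] : (couplings μ ν).Nonempty :=
  ⟨⟨μ.prod ν, inferInstance⟩, Measure.fst_prod, Measure.snd_prod⟩

theorem mass_of_mem_couplings {μ : Measure X} [IsProbabilityMeasure μ] {ν : Measure Y}
    {π : FiniteMeasure (X × Y)} (h : π ∈ couplings μ ν) : π.mass = 1 := by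
  have h1 : (π : Measure (X × Y)) univ = 1 := by
    rw [← Measure.fst_univ, h.1, measure_univ]
  rw [← ENNReal.coe_inj, FiniteMeasure.ennreal_mass, h1, ENNReal.coe_one]

theorem uotObjective_eq_of_mem_couplings
    (hΨ₁ : IsEntropyFunction Ψ₁) (hΨ₂ : IsEntropyFunction Ψ₂)
    (hn₁ : IsNormalized Ψ₁) (hn₂ : IsNormalized Ψ₂)
    {μ : Measure X} [IsFiniteMeasure μ] {ν : Measure Y} [IsFiniteMeasure ν] (α : ℝ)
    {π : FiniteMeasure (X × Y)} (hπ : π ∈ couplings μ ν) :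
    uotObjective c Ψ₁ Ψ₂ μ ν α π = transportCost c π := by
  simp [uotObjective, hπ.1, hπ.2, csiszarDiv_self hΨ₁ hn₁, csiszarDiv_self hΨ₂ hn₂]

theorem uotObjective_mono (μ : Measure X) (ν : Measure Y) (π : FiniteMeasure (X × Y)) :
    Monotone fun α => uotObjective c Ψ₁ Ψ₂ μ ν α π := fun α β h => by
  dsimp only [uotObjective]
  gcongr

/-- A plan has the same mass as its first marginal, so the first penalty alone bounds it. -/
theorem exists_mass_le_of_uotObjective_le
    (hΨ₁ : IsEntropyFunction Ψ₁) (hn₁ : IsNormalized Ψ₁) (hf₁ : ∀ x ∈ Ioi (0 : ℝ), Ψ₁ x ≠ ⊤)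
    (μ : Measure X) [IsFiniteMeasure μ] (ν : Measure Y) {α : ℝ} (hα : 0 < α)
    {C : ℝ≥0∞} (hC : C ≠ ⊤) :
    ∃ M : ℝ≥0, ∀ π : FiniteMeasure (X × Y), uotObjective c Ψ₁ Ψ₂ μ ν α π ≤ C → π.mass ≤ M := by
  have hα' : ENNReal.ofReal α ≠ 0 := (ENNReal.ofReal_pos.2 hα).ne'
  obtain ⟨M, hM⟩ := exists_measure_univ_le_of_csiszarDiv_le hΨ₁ hn₁ hf₁ μ
    (ENNReal.div_ne_top hC hα')
  refine ⟨M, fun π hπ => ?_⟩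
  have h1 : ENNReal.ofReal α * csiszarDiv Ψ₁ (π : Measure (X × Y)).fst μ ≤ C :=
    le_trans (le_trans le_add_self le_self_add) hπ
  have h2 := hM (π : Measure (X × Y)).fst inferInstance
    ((ENNReal.le_div_iff_mul_le (Or.inl hα') (Or.inl ENNReal.ofReal_ne_top)).2
      (by rwa [mul_comm]))
  rw [Measure.fst_univ, ← FiniteMeasure.ennreal_mass] at h2
  exact_mod_cast h2

end Plans

section Cost

variable {X Y : Type*} [TopologicalSpace X] [CompactSpace X] [MeasurableSpace X]
    [TopologicalSpace Y] [CompactSpace Y] [MeasurableSpace Y] {c : X × Y → ℝ≥0}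

theorem continuous_transportCost [OpensMeasurableSpace (X × Y)] (hc : Continuous c) :
    Continuous (transportCost c : FiniteMeasure (X × Y) → ℝ≥0∞) :=
  FiniteMeasure.continuous_lintegral_continuousMap (⟨c, hc⟩ : C(X × Y, ℝ≥0))

theorem transportCost_ne_top (hc : Continuous c) (π : FiniteMeasure (X × Y)) :
    transportCost c π ≠ ⊤ := by
  let f : BoundedContinuousFunction (X × Y) ℝ≥0 := BoundedContinuousFunction.mkOfCompact ⟨c, hc⟩
  exact (f.lintegral_lt_top_of_nnreal (π : Measure (X × Y))).ne

end Cost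

/-! ### Existence of optimal plans and the limit of large `α`. -/

section Transport

theorem isClosed_couplings {X Y : Type*}
    [TopologicalSpace X] [PolishSpace X] [MeasurableSpace X] [BorelSpace X]
    [TopologicalSpace Y] [PolishSpace Y] [MeasurableSpace Y] [BorelSpace Y]
    (μ : Measure X) [IsFiniteMeasure μ] (ν : Measure Y) [IsFiniteMeasure ν] : IsClosed (couplings μ ν) := by
  let μ' : FiniteMeasure X := ⟨μ, inferInstance⟩
  let ν' : FiniteMeasure Y := ⟨ν, inferInstance⟩
  have h : couplings μ ν = {π | π.map Prod.fst = μ'} ∩ {π | π.map Prod.snd = ν'} := by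
    ext π
    change (π.map Prod.fst : Measure X) = (μ' : Measure X) ∧
      (π.map Prod.snd : Measure Y) = (ν' : Measure Y) ↔ π.map Prod.fst = μ' ∧ π.map Prod.snd = ν'
    rw [FiniteMeasure.toMeasure_injective.eq_iff, FiniteMeasure.toMeasure_injective.eq_iff]
  rw [h]
  exact (isClosed_eq (FiniteMeasure.continuous_map continuous_fst) continuous_const).inter
    (isClosed_eq (FiniteMeasure.continuous_map continuous_snd) continuous_const)

variable {X Y : Type*}
    [TopologicalSpace X] [PolishSpace X] [CompactSpace X] [MeasurableSpace X] [BorelSpace X]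
    [TopologicalSpace Y] [PolishSpace Y] [CompactSpace Y] [MeasurableSpace Y] [BorelSpace Y]
    {c : X × Y → ℝ≥0} {Ψ₁ Ψ₂ : ℝ → ℝ≥0∞}

theorem otPlans_nonempty (hc : Continuous c) (μ : Measure X) [IsProbabilityMeasure μ]
    (ν : Measure Y) [IsProbabilityMeasure ν] : (otPlans c μ ν).Nonempty := by
  have hcomp : IsCompact (couplings μ ν) :=
    (isCompact_setOfPred_finiteMeasure_le_of_compactSpace (X × Y) 1).of_isClosed_subset
      (isClosed_couplings μ ν) fun π hπ => (mass_of_mem_couplings hπ).le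
  obtain ⟨π, hπ, hmin⟩ := hcomp.exists_isMinOn (couplings_nonempty μ ν)
    (continuous_transportCost hc).continuousOn
  exact ⟨π, hπ, le_antisymm (le_iInf₂ fun σ hσ => hmin hσ) (iInf₂_le π hπ)⟩

theorem lowerSemicontinuous_uotObjective (hc : Continuous c)
    (hΨ₁ : IsEntropyFunction Ψ₁) (hΨ₂ : IsEntropyFunction Ψ₂)
    (hn₁ : IsNormalized Ψ₁) (hn₂ : IsNormalized Ψ₂)
    (hf₁ : ∀ x ∈ Ioi (0 : ℝ), Ψ₁ x ≠ ⊤) (hf₂ : ∀ x ∈ Ioi (0 : ℝ), Ψ₂ x ≠ ⊤)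
    (μ : Measure X) [IsFiniteMeasure μ] (ν : Measure Y) [IsFiniteMeasure ν] (α : ℝ) :
    LowerSemicontinuous (uotObjective c Ψ₁ Ψ₂ μ ν α) := by
  have hα : Continuous fun t : ℝ≥0∞ => ENNReal.ofReal α * t :=
    ENNReal.continuous_const_mul ENNReal.ofReal_ne_top
  have hαm : Monotone fun t : ℝ≥0∞ => ENNReal.ofReal α * t := fun _ _ h => mul_le_mul_right h _
  have h₁ := LowerSemicontinuous.comp (lowerSemicontinuous_csiszarDiv hΨ₁ hn₁ hf₁ μ)
    (FiniteMeasure.continuous_map (continuous_fst (X := X) (Y := Y)))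
  have h₂ := LowerSemicontinuous.comp (lowerSemicontinuous_csiszarDiv hΨ₂ hn₂ hf₂ ν)
    (FiniteMeasure.continuous_map (continuous_snd (X := X) (Y := Y)))
  exact ((continuous_transportCost hc).lowerSemicontinuous.add
    (hα.comp_lowerSemicontinuous h₁ hαm)).add (hα.comp_lowerSemicontinuous h₂ hαm)

theorem uotPlans_nonempty (hc : Continuous c)
    (hΨ₁ : IsEntropyFunction Ψ₁) (hΨ₂ : IsEntropyFunction Ψ₂)
    (hn₁ : IsNormalized Ψ₁) (hn₂ : IsNormalized Ψ₂)
    (hf₁ : ∀ x ∈ Ioi (0 : ℝ), Ψ₁ x ≠ ⊤) (hf₂ : ∀ x ∈ Ioi (0 : ℝ), Ψ₂ x ≠ ⊤)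
    (μ : Measure X) [IsProbabilityMeasure μ] (ν : Measure Y) [IsProbabilityMeasure ν]
    {α : ℝ} (hα : 0 < α) : (uotPlans c Ψ₁ Ψ₂ μ ν α).Nonempty := by
  obtain ⟨π₀, hπ₀⟩ := couplings_nonempty μ ν
  have hfin : uotObjective c Ψ₁ Ψ₂ μ ν α π₀ ≠ ⊤ := by
    rw [uotObjective_eq_of_mem_couplings hΨ₁ hΨ₂ hn₁ hn₂ α hπ₀]
    exact transportCost_ne_top hc π₀
  obtain ⟨M, hM⟩ := exists_mass_le_of_uotObjective_le (c := c) (Ψ₂ := Ψ₂) hΨ₁ hn₁ hf₁ μ ν hα hfin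
  obtain ⟨π, -, hmin⟩ := LowerSemicontinuousOn.exists_isMinOn ⟨π₀, hM π₀ le_rfl⟩
    (isCompact_setOfPred_finiteMeasure_le_of_compactSpace (X × Y) M)
    ((lowerSemicontinuous_uotObjective hc hΨ₁ hΨ₂ hn₁ hn₂ hf₁ hf₂ μ ν α).lowerSemicontinuousOn _)
  refine ⟨π, le_antisymm (le_iInf fun σ => ?_) (iInf_le _ π)⟩
  -- A competitor no worse than `π₀` lies in the compact mass ball; any other is beaten by `π₀`.
  rcases le_total (uotObjective c Ψ₁ Ψ₂ μ ν α σ) (uotObjective c Ψ₁ Ψ₂ μ ν α π₀) with h | h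
  · exact hmin (hM σ h)
  · exact (hmin (hM π₀ le_rfl)).trans h

theorem uotObjective_le_otValue_of_mem_uotPlans (hc : Continuous c)
    (hΨ₁ : IsEntropyFunction Ψ₁) (hΨ₂ : IsEntropyFunction Ψ₂)
    (hn₁ : IsNormalized Ψ₁) (hn₂ : IsNormalized Ψ₂)
    {μ : Measure X} [IsProbabilityMeasure μ] {ν : Measure Y} [IsProbabilityMeasure ν]
    {α : ℝ} {π : FiniteMeasure (X × Y)} (hπ : π ∈ uotPlans c Ψ₁ Ψ₂ μ ν α) :
    uotObjective c Ψ₁ Ψ₂ μ ν α π ≤ otValue c μ ν := by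
  obtain ⟨σ, hσ, hσv⟩ := otPlans_nonempty hc μ ν
  rw [show uotObjective c Ψ₁ Ψ₂ μ ν α π = uotValue c Ψ₁ Ψ₂ μ ν α from hπ, ← hσv,
    ← uotObjective_eq_of_mem_couplings hΨ₁ hΨ₂ hn₁ hn₂ α hσ]
  exact iInf_le _ σ

/-- A plan that is not optimal for the balanced problem is eventually too expensive for the
unbalanced ones. -/
theorem exists_otValue_lt_uotObjective (hc : Continuous c)
    (hΨ₁ : IsEntropyFunction Ψ₁) (hΨ₂ : IsEntropyFunction Ψ₂)
    (hn₁ : IsNormalized Ψ₁) (hn₂ : IsNormalized Ψ₂)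
    (hf₁ : ∀ x ∈ Ioi (0 : ℝ), Ψ₁ x ≠ ⊤) (hf₂ : ∀ x ∈ Ioi (0 : ℝ), Ψ₂ x ≠ ⊤)
    {μ : Measure X} [IsProbabilityMeasure μ] {ν : Measure Y} [IsProbabilityMeasure ν]
    {π : FiniteMeasure (X × Y)} (hπ : π ∉ otPlans c μ ν) :
    ∃ n : ℕ, otValue c μ ν < uotObjective c Ψ₁ Ψ₂ μ ν n π := by
  by_contra! h
  have hfin : otValue c μ ν ≠ ⊤ := by
    obtain ⟨σ, -, hσv⟩ := otPlans_nonempty hc μ ν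
    exact hσv ▸ transportCost_ne_top hc σ
  have hzero : ∀ D : ℝ≥0∞, (∀ n : ℕ, ENNReal.ofReal n * D ≤ otValue c μ ν) → D = 0 := by
    intro D hD
    by_contra hD0
    obtain ⟨n, hn⟩ := ENNReal.exists_nat_mul_gt hD0 hfin
    exact absurd (hD n) (not_le.2 (by simpa using hn))
  have h₁ : (π : Measure (X × Y)).fst = μ := eq_of_csiszarDiv_eq_zero hΨ₁ hn₁ hf₁ <|
    hzero _ fun n => le_trans (le_trans le_add_self le_self_add) (h n)
  have h₂ : (π : Measure (X × Y)).snd = ν := eq_of_csiszarDiv_eq_zero hΨ₂ hn₂ hf₂ <|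
    hzero _ fun n => le_add_self.trans (h n)
  refine hπ ⟨⟨h₁, h₂⟩, le_antisymm ?_ (iInf₂_le π ⟨h₁, h₂⟩)⟩
  exact le_trans (le_trans le_self_add le_self_add) (h 0)

theorem eventually_uotPlans_subset (hc : Continuous c)
    (hΨ₁ : IsEntropyFunction Ψ₁) (hΨ₂ : IsEntropyFunction Ψ₂)
    (hn₁ : IsNormalized Ψ₁) (hn₂ : IsNormalized Ψ₂)
    (hf₁ : ∀ x ∈ Ioi (0 : ℝ), Ψ₁ x ≠ ⊤) (hf₂ : ∀ x ∈ Ioi (0 : ℝ), Ψ₂ x ≠ ⊤)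
    (μ : Measure X) [IsProbabilityMeasure μ] (ν : Measure Y) [IsProbabilityMeasure ν]
    {U : Set (FiniteMeasure (X × Y))} (hU : IsOpen U) (hsub : otPlans c μ ν ⊆ U) :
    ∀ᶠ α : ℝ in atTop, uotPlans c Ψ₁ Ψ₂ μ ν α ⊆ U := by
  have hfin : otValue c μ ν ≠ ⊤ := by
    obtain ⟨σ, -, hσv⟩ := otPlans_nonempty hc μ ν
    exact hσv ▸ transportCost_ne_top hc σ
  -- The mass bound at `α = 1` serves all `α ≥ 1`, by monotonicity of the objective in `α`.
  obtain ⟨M, hM⟩ := exists_mass_le_of_uotObjective_le (c := c) (Ψ₂ := Ψ₂) hΨ₁ hn₁ hf₁ μ ν one_pos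
    hfin
  have hK := (isCompact_setOfPred_finiteMeasure_le_of_compactSpace (X × Y) M).diff hU
  -- The cover is open by lower semicontinuity and increasing in `n`, so one member contains the
  -- compact set.
  obtain ⟨n, hcover⟩ := hK.elim_directed_cover
    (fun n : ℕ => {π | otValue c μ ν < uotObjective c Ψ₁ Ψ₂ μ ν n π})
    (fun n => (lowerSemicontinuous_uotObjective hc hΨ₁ hΨ₂ hn₁ hn₂ hf₁ hf₂ μ ν n).isOpen_preimage _)
    (fun π hπ => mem_iUnion.2 <| exists_otValue_lt_uotObjective hc hΨ₁ hΨ₂ hn₁ hn₂ hf₁ hf₂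
      fun h => hπ.2 (hsub h))
    (directed_of_isDirected_le fun m n hmn π hπ =>
      lt_of_lt_of_le hπ (uotObjective_mono μ ν π (Nat.cast_le.2 hmn)))
  filter_upwards [eventually_ge_atTop (1 : ℝ), eventually_ge_atTop (n : ℝ)] with α hα1 hαn π hπ
  have hle := uotObjective_le_otValue_of_mem_uotPlans hc hΨ₁ hΨ₂ hn₁ hn₂ hπ
  by_contra hπU
  exact absurd (hcover ⟨hM π ((uotObjective_mono μ ν π hα1).trans hle), hπU⟩)
    (not_lt.2 ((uotObjective_mono μ ν π hαn).trans hle))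

end Transport

end UOT

theorem theorem2 {X Y : Type*}
    [TopologicalSpace X] [PolishSpace X] [CompactSpace X] [MeasurableSpace X] [BorelSpace X]
    [TopologicalSpace Y] [PolishSpace Y] [CompactSpace Y] [MeasurableSpace Y] [BorelSpace Y]
    (μ : Measure X) [IsProbabilityMeasure μ] (ν : Measure Y) [IsProbabilityMeasure ν]
    (c : X × Y → ℝ≥0) (hc : Continuous c)
    (Ψ₁ Ψ₂ : ℝ → ℝ≥0∞)
    (hΨ₁ : UOT.IsEntropyFunction Ψ₁) (hΨ₂ : UOT.IsEntropyFunction Ψ₂)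
    (hn₁ : UOT.IsNormalized Ψ₁) (hn₂ : UOT.IsNormalized Ψ₂)
    (hs₁ : StrictConvexOn ℝ≥0 (Ioi (0 : ℝ)) Ψ₁) (hs₂ : StrictConvexOn ℝ≥0 (Ioi (0 : ℝ)) Ψ₂)
    (hf₁ : ∀ x ∈ Ioi (0 : ℝ), Ψ₁ x ≠ ⊤) (hf₂ : ∀ x ∈ Ioi (0 : ℝ), Ψ₂ x ≠ ⊤) :
    -- optimal plans exist
    (UOT.otPlans c μ ν).Nonempty ∧
    (∀ α : ℝ, 0 < α → (UOT.uotPlans c Ψ₁ Ψ₂ μ ν α).Nonempty) ∧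
    -- weak convergence to the optimal plan
    (∀ (πα : ℝ → FiniteMeasure (X × Y)) (πstar : FiniteMeasure (X × Y)),
      (∀ α : ℝ, 0 < α → πα α ∈ UOT.uotPlans c Ψ₁ Ψ₂ μ ν α) →
      UOT.otPlans c μ ν = {πstar} →
      Tendsto πα atTop (𝓝 πstar)) ∧
    -- without uniqueness: weak convergence to the set of optimal plans
    (∀ U : Set (FiniteMeasure (X × Y)), IsOpen U → UOT.otPlans c μ ν ⊆ U →
      ∀ᶠ α : ℝ in atTop, UOT.uotPlans c Ψ₁ Ψ₂ μ ν α ⊆ U) := by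
  refine ⟨UOT.otPlans_nonempty hc μ ν,
    fun α hα => UOT.uotPlans_nonempty hc hΨ₁ hΨ₂ hn₁ hn₂ hf₁ hf₂ μ ν hα,
    fun πα πstar hπα hstar => ?_,
    fun U hU hsub => UOT.eventually_uotPlans_subset hc hΨ₁ hΨ₂ hn₁ hn₂ hf₁ hf₂ μ ν hU hsub⟩
  refine tendsto_nhds.2 fun U hU hmem => ?_
  have hsub : UOT.otPlans c μ ν ⊆ U := by simpa [hstar] using hmem
  filter_upwards [UOT.eventually_uotPlans_subset hc hΨ₁ hΨ₂ hn₁ hn₂ hf₁ hf₂ μ ν hU hsub,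
    eventually_gt_atTop (0 : ℝ)] with α hα hα0
  exact hα (hπα α hα0)
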